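/- Let $\bar S$ be a finite set of options, each option $i$ having a salvage value $\xi_i\in\mathbb R$, let $\Omega$ be a finite set of customer types, and let $X$ be an $\Omega$-valued random variable (the type of an arriving customer). In each period a customer arrives with probability $\mu\in(0,1]$; for demand $\lambda\ge 0$ the season has $T(\lambda)=\lfloor\lambda/\mu\rfloor$ periods. A choice function $f$ on $\bar S$ assigns to each type $\omega$, each $S\subseteq\bar S$ and each price vector $p\in\mathbb R^{S}$ numbers $f^\omega_i(p,S)\in[0,1]$, such that $f^\omega(\cdot,S):\mathbb R^S\to[0,1]^S$ is differentiable and, for all $\omega$ and $S$: (1) $\sum_{i\in S}f_i^\omega(p,S)\le 1$; (2) $f_i^\omega(p,S)=0$ for $i\notin S$; (3) $p_i f_i^\omega(p,S)\to0$ as $p_i\to\infty$ with the other prices fixed, for $i\in S$; (4) there is $\tilde f^\omega:\mathbb R^S\times[0,1]^S\to[0,1]^S$ whose components $\tilde f_i^\omega(p,a)$ are non-increasing and convex in $a$, with $\tilde f^\omega_i(p,a(S'))=f^\omega_i(p|_{S'},S')$ whenever $i\in S'\subseteq S$, where $a_j(S')=1$ if $j\in S'$ and $a_j(S')=0$ otherwise;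 (5) for $i\in\bar S$ the derivative of $x\mapsto f_i^\omega(x,\{i\})$, $x\in\mathbb R$, vanishes nowhere and $x\mapsto x+f_i^\omega(x,\{i\})/\partial_x f_i^\omega(x,\{i\})$ is non-decreasing. For $S\subseteq\bar S$ and $\Delta\in\mathbb R^{S}$ put $R(f^\omega,S,\Delta)=\sup_{p\in\mathbb R^{S}}\sum_{i\in S}f_i^\omega(p,S)(p_i-\Delta_i)$. The optimal value is defined by $V^*_0(S)=\sum_{i\in S}\xi_i$ and, for $t\ge1$, $$V^*_t(S)=V^*_{t-1}(S)+\mu\,\mathbb E_X\big[R\big(f^X,S,(V^*_{t-1}(S)-V^*_{t-1}(S\setminus\{i\}))_{i\in S}\big)\big].$$ The backward bound is $V^U_t(S)=\sum_{i\in S}r_{t,i}$, where $r_{0,i}=\xi_i$ and, for $t\ge 1$, $$r_{t,i}=r_{t-1,i}+\mu\,\mathbb E_X\Big[\sup_{x\in\mathbb R}f^X_i(x,\{i\})(x-r_{t-1,i})\Big].$$ (a) For every choice function $f$ on $\bar S$, all these suprema are finite, and $V^*_t(S)\le V^U_t(S)$ for all $S\subseteq\bar S$ and all integers $t\ge0$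 (in particular for $t\in\{0,\dots,T(\lambda)\}$, for every $\lambda$). (b) Let $f$ be the multinomial logit choice function $$f_i^\omega(p,S)=\frac{e^{q_i^\omega+\beta p_i}}{1+\sum_{j\in S}e^{q_j^\omega+\beta p_j}}\quad(i\in S),\qquad f_i^\omega(p,S)=0\quad(i\notin S),$$ with arbitrary qualities $q_i^\omega\in\mathbb R$ and price sensitivity $\beta<0$. Then these suprema are finite and, for every $S\subseteq\bar S$, with $\mu,\xi,q,\beta$ and the law of $X$ fixed, $\lim_{\lambda\to\infty}\big(V^*_{T(\lambda)}(S)-V^U_{T(\lambda)}(S)\big)=0$. -/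

import Mathlib

open Filter Topology

noncomputable section

/-- A family of selection probabilities for one customer type: `g S p i` is the probability that
option `i` is accepted when the set of options `S` is displayed at the price vector `p ∈ ℝ^S`. -/
abbrev SelectionProb (ι : Type*) : Type _ := (S : Finset ι) → (S → ℝ) → ι → ℝ

/-- The availability vector `a(S')` of `S'`, as an element of `[0,1]^S`. -/
def availability {ι : Type*} [DecidableEq ι] (S S' : Finset ι) : S → ℝ :=
  fun j => if (j : ι) ∈ S' then 1 else 0

/-- `f` is a choice function on the subsets of the set of options `Sbar`, for customers whose
types range over `Ω`. -/
structure IsChoiceFunction {ι Ω : Type*} [DecidableEq ι] (Sbar : Finset ι)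
    (f : Ω → SelectionProb ι) : Prop where
  /-- the values are probabilities -/
  mem_Icc : ∀ ω, ∀ S ⊆ Sbar, ∀ (p : S → ℝ) (i : ι), f ω S p i ∈ Set.Icc (0 : ℝ) 1
  /-- `f^ω(·, S) : ℝ^S → [0,1]^S` is differentiable -/
  differentiable : ∀ ω, ∀ S ⊆ Sbar, Differentiable ℝ (fun (p : S → ℝ) (i : S) => f ω S p i)
  /-- the selection probabilities add up to at most one -/
  sum_le_one : ∀ ω, ∀ S ⊆ Sbar, ∀ p : S → ℝ, ∑ i : S, f ω S p i ≤ 1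
  /-- only displayed options can be selected -/
  eq_zero_of_notMem : ∀ ω, ∀ S ⊆ Sbar, ∀ (p : S → ℝ), ∀ i ∉ S, f ω S p i = 0
  /-- `p_i f_i^ω(p, S) → 0` as `p_i → ∞`, the other prices being fixed -/
  tendsto_price_mul : ∀ ω, ∀ S ⊆ Sbar, ∀ (p : S → ℝ) (i : S),
    Tendsto (fun x : ℝ => x * f ω S (Function.update p i x) i) atTop (𝓝 0)
  /-- `f^ω` has an extension to fractional availabilities that is non-increasing and convex
  in the availability vector -/
  extension : ∀ ω, ∀ S ⊆ Sbar, ∃ ft : (S → ℝ) → (S → ℝ) → S → ℝ,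
    (∀ p, ∀ a ∈ Set.Icc (0 : S → ℝ) 1, ∀ i, ft p a i ∈ Set.Icc (0 : ℝ) 1) ∧
    (∀ p i, AntitoneOn (fun a => ft p a i) (Set.Icc (0 : S → ℝ) 1)) ∧
    (∀ p i, ConvexOn ℝ (Set.Icc (0 : S → ℝ) 1) (fun a => ft p a i)) ∧
    (∀ (p : S → ℝ) (S' : Finset ι) (h : S' ⊆ S) (i : S), (i : ι) ∈ S' →
      ft p (availability S S') i = f ω S' (fun j : S' => p ⟨j, h j.2⟩) i)
  /-- for a single option, `p ↦ p + f / f'` is well defined and non-decreasing -/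
  monotone_price_add : ∀ ω, ∀ i ∈ Sbar,
    (∀ x : ℝ, deriv (fun y : ℝ => f ω {i} (fun _ => y) i) x ≠ 0) ∧
    Monotone (fun x : ℝ => x +
      f ω {i} (fun _ => x) i / deriv (fun y : ℝ => f ω {i} (fun _ => y) i) x)

/-- Multinomial logit selection probabilities with qualities `q` and price sensitivity `β`. -/
def mnl {ι Ω : Type*} [DecidableEq ι] (q : Ω → ι → ℝ) (β : ℝ) : Ω → SelectionProb ι :=
  fun ω S p i =>
    if h : i ∈ S then
      Real.exp (q ω i + β * p ⟨i, h⟩) / (1 + ∑ j : S, Real.exp (q ω j + β * p j))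
    else 0

/-- Expected gain `∑_{i ∈ S} g_i(p, S) (p_i - Δ_i)` of one stage, at the price vector `p`. -/
def stageGain {ι : Type*} (g : SelectionProb ι) (S : Finset ι) (Δ : ι → ℝ) (p : S → ℝ) : ℝ :=
  ∑ i : S, g S p i * (p i - Δ i)

/-- Optimal value of the single-stage pricing problem. -/
def stageValue {ι : Type*} (g : SelectionProb ι) (S : Finset ι) (Δ : ι → ℝ) : ℝ :=
  ⨆ p : S → ℝ, stageGain g S Δ p

/-- The optimal value `V*_t(S)` with `t` periods to go, given by the Bellman equation; `μ` is the
arrival probability per period, `P` the distribution of types and `ξ` the salvage values. -/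
def optimalValue {ι Ω : Type*} [DecidableEq ι] [Fintype Ω] (μ : ℝ) (P : Ω → ℝ) (ξ : ι → ℝ)
    (f : Ω → SelectionProb ι) : ℕ → Finset ι → ℝ
  | 0, S => ∑ i ∈ S, ξ i
  | t + 1, S => optimalValue μ P ξ f t S +
      μ * ∑ ω, P ω * stageValue (f ω) S
        (fun i => optimalValue μ P ξ f t S - optimalValue μ P ξ f t (S.erase i))

/-- The individual upper bound `r_{t,i}` of option `i`. -/
def individualBound {ι Ω : Type*} [Fintype Ω] (μ : ℝ) (P : Ω → ℝ) (ξ : ι → ℝ)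
    (f : Ω → SelectionProb ι) : ℕ → ι → ℝ
  | 0, i => ξ i
  | t + 1, i => individualBound μ P ξ f t i +
      μ * ∑ ω, P ω *
        ⨆ x : ℝ, f ω {i} (fun _ => x) i * (x - individualBound μ P ξ f t i)

/-- The backward upper bound `V^U_t(S) = ∑_{i ∈ S} r_{t,i}`. -/
def backwardBound {ι Ω : Type*} [Fintype Ω] (μ : ℝ) (P : Ω → ℝ) (ξ : ι → ℝ)
    (f : Ω → SelectionProb ι) (t : ℕ) (S : Finset ι) : ℝ :=
  ∑ i ∈ S, individualBound μ P ξ f t i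

/-- The number of periods `T(lam) = ⌊lam / μ⌋` of a season with demand `lam`. -/
def numPeriods (μ lam : ℝ) : ℕ := ⌊lam / μ⌋₊

end

/-! Both halves use only that an option sells at least as often when shown alone at the same price
and that the probabilities add up to at most one. These are isolated in `IsSubstitutable`, so that
logit satisfies them directly.

(a) Let `d` be the gap `V^U - V*` at `S`. Induction on `S \ {i}` gives `Δ_i ≥ r_i - d`. Lowering the
costs to `r_i - d` adds at most `d` to the stage value, and at cost `r` the stage splits into single
options; `μ d ≤ d` closes the induction.

(b) A single logit option with cost `r` has optimal gain `w / (-β)`, where `w e^w = e^{q + βr - 1}`.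
Charging these single-option prices jointly bounds the stage value below
(`sum_sub_stageValue_mnl_le`). The gap `D_t` then satisfies `D_{t+1} ≤ D_t + a_t (δ_t - D_t)`, with
`δ_t → 0` by induction on `S` and since `r_t → ∞`. The sum of the `a_t` diverges because `a_t`
dominates a multiple of an increment of `r_t`; hence `D_t → 0`. -/

/-- The properties of selection probabilities that bound the value of a set of options by the
values of its single options. -/
structure IsSubstitutable {ι : Type*} (Sbar : Finset ι) (g : SelectionProb ι) : Prop where
  nonneg : ∀ S ⊆ Sbar, ∀ (p : S → ℝ) (i : ι), 0 ≤ g S p i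
  sum_le_one : ∀ S ⊆ Sbar, ∀ p : S → ℝ, ∑ i : S, g S p i ≤ 1
  le_single : ∀ S ⊆ Sbar, ∀ (p : S → ℝ) (i : S), g S p i ≤ g {(i : ι)} (fun _ => p i) i
  bddAbove_single : ∀ i ∈ Sbar, ∀ r : ℝ,
    BddAbove (Set.range fun x : ℝ => g {i} (fun _ => x) i * (x - r))

lemma bddAbove_mul_sub_of_tendsto {g : ℝ → ℝ} (h0 : ∀ x, 0 ≤ g x) (h1 : ∀ x, g x ≤ 1)
    (h : Tendsto (fun x => x * g x) atTop (𝓝 0)) (r : ℝ) :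
    BddAbove (Set.range fun x => g x * (x - r)) := by
  obtain ⟨N, hN⟩ := eventually_atTop.1 (h.eventually (gt_mem_nhds zero_lt_one))
  refine ⟨1 + |N| + |r|, ?_⟩
  rintro _ ⟨x, rfl⟩
  have hr : -(g x * r) ≤ |r| := by
    calc -(g x * r) = g x * -r := (mul_neg _ _).symm
      _ ≤ g x * |r| := mul_le_mul_of_nonneg_left (neg_le_abs r) (h0 x)
      _ ≤ |r| := mul_le_of_le_one_left (abs_nonneg r) (h1 x)
  have hx : g x * x ≤ 1 + |N| := by
    rcases le_total N x with hNx | hNx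
    · have := hN x hNx
      have := abs_nonneg N
      linarith [mul_comm x (g x)]
    · calc g x * x ≤ g x * |N| := mul_le_mul_of_nonneg_left (hNx.trans (le_abs_self N)) (h0 x)
        _ ≤ 1 * |N| := mul_le_mul_of_nonneg_right (h1 x) (abs_nonneg N)
        _ ≤ 1 + |N| := by linarith
  linarith [mul_sub (g x) x r]

theorem IsChoiceFunction.isSubstitutable {ι Ω : Type*} [DecidableEq ι] {Sbar : Finset ι}
    {f : Ω → SelectionProb ι} (hf : IsChoiceFunction Sbar f) (ω : Ω) :
    IsSubstitutable Sbar (f ω) where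
  nonneg S hS p i := (hf.mem_Icc ω S hS p i).1
  sum_le_one := hf.sum_le_one ω
  le_single S hS p i := by
    obtain ⟨ft, -, hanti, -, heq⟩ := hf.extension ω S hS
    have hi : ({(i : ι)} : Finset ι) ⊆ S := Finset.singleton_subset_iff.2 i.2
    have hmem : ∀ S' : Finset ι, availability S S' ∈ Set.Icc (0 : S → ℝ) 1 := fun S' =>
      ⟨fun j => by unfold availability; split_ifs <;> simp,
        fun j => by unfold availability; split_ifs <;> simp⟩
    have hle : availability S {(i : ι)} ≤ availability S S := fun j => by
      simp only [availability, j.2, if_true]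
      split_ifs <;> simp
    -- Showing fewer options lowers the availability vector, and the extension is antitone in it.
    have h := hanti p i (hmem _) (hmem _) hle
    have h2 := heq p _ hi i (Finset.mem_singleton_self _)
    have h3 : (fun j : ({(i : ι)} : Finset ι) => p ⟨j, hi j.2⟩) = fun _ => p i := by
      funext j
      exact congrArg p (Subtype.ext (Finset.mem_singleton.1 j.2))
    rw [h3] at h2
    have h1 := heq p S subset_rfl i i.2
    exact h1.symm.le.trans (h.trans h2.le)
  bddAbove_single i hi r := by
    have hS : ({i} : Finset ι) ⊆ Sbar := Finset.singleton_subset_iff.2 hi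
    refine bddAbove_mul_sub_of_tendsto (fun x => (hf.mem_Icc ω _ hS _ i).1)
      (fun x => (hf.mem_Icc ω _ hS _ i).2) ?_ r
    have h := hf.tendsto_price_mul ω _ hS (fun _ => 0) ⟨i, Finset.mem_singleton_self i⟩
    refine h.congr fun x => ?_
    congr 2
    funext j
    have hj : j = ⟨i, Finset.mem_singleton_self i⟩ := Subtype.ext (Finset.mem_singleton.1 j.2)
    rw [hj, Function.update_self]

namespace IsSubstitutable

variable {ι : Type*} {Sbar : Finset ι} {g : SelectionProb ι}

lemma single_iSup_nonneg (hg : IsSubstitutable Sbar g) {i : ι} (hi : i ∈ Sbar) (r : ℝ) :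
    0 ≤ ⨆ x : ℝ, g {i} (fun _ => x) i * (x - r) := by
  have := le_ciSup (hg.bddAbove_single i hi r) r
  simpa using this

lemma stageGain_le_sum_iSup (hg : IsSubstitutable Sbar g) {S : Finset ι} (hS : S ⊆ Sbar)
    (Δ : ι → ℝ) (p : S → ℝ) :
    stageGain g S Δ p ≤ ∑ i ∈ S, ⨆ x : ℝ, g {i} (fun _ => x) i * (x - Δ i) := by
  rw [← Finset.sum_coe_sort S, stageGain]
  refine Finset.sum_le_sum fun i _ => ?_
  -- Below cost the comparison of probabilities reverses, but the term is nonpositive while the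
  -- supremum is nonnegative.
  rcases le_total 0 (p i - Δ i) with h | h
  · exact (mul_le_mul_of_nonneg_right (hg.le_single S hS p i) h).trans
      (le_ciSup (hg.bddAbove_single i (hS i.2) (Δ i)) (p i))
  · exact (mul_nonpos_of_nonneg_of_nonpos (hg.nonneg S hS p i) h).trans
      (hg.single_iSup_nonneg (hS i.2) _)

lemma bddAbove_stageGain (hg : IsSubstitutable Sbar g) {S : Finset ι} (hS : S ⊆ Sbar)
    (Δ : ι → ℝ) : BddAbove (Set.range (stageGain g S Δ)) :=
  ⟨_, Set.forall_mem_range.2 (hg.stageGain_le_sum_iSup hS Δ)⟩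

/-- Lowering all opportunity costs by at most `d` raises the value of a stage by at most `d`. -/
lemma stageValue_le_add (hg : IsSubstitutable Sbar g) {S : Finset ι} (hS : S ⊆ Sbar)
    {Δ r : ι → ℝ} {d : ℝ} (hd : 0 ≤ d) (h : ∀ i ∈ S, r i ≤ Δ i + d) :
    stageValue g S Δ ≤ (∑ i ∈ S, ⨆ x : ℝ, g {i} (fun _ => x) i * (x - r i)) + d := by
  refine ciSup_le fun p => ?_
  have h1 : stageGain g S Δ p ≤ stageGain g S r p + ∑ i : S, g S p i * d := by
    rw [stageGain, stageGain, ← Finset.sum_add_distrib]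
    refine Finset.sum_le_sum fun i _ => ?_
    rw [← mul_add]
    exact mul_le_mul_of_nonneg_left (by linarith [h i i.2]) (hg.nonneg S hS p i)
  have h2 : ∑ i : S, g S p i * d ≤ d := by
    rw [← Finset.sum_mul]
    exact mul_le_of_le_one_left hd (hg.sum_le_one S hS p)
  linarith [hg.stageGain_le_sum_iSup hS r p]

end IsSubstitutable

/-! ### The backward bound dominates the optimal value -/

lemma backwardBound_succ {ι Ω : Type*} [Fintype Ω] (μ : ℝ) (P : Ω → ℝ) (ξ : ι → ℝ)
    (f : Ω → SelectionProb ι) (t : ℕ) (S : Finset ι) :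
    backwardBound μ P ξ f (t + 1) S = backwardBound μ P ξ f t S + μ * ∑ ω, P ω * ∑ i ∈ S,
      ⨆ x : ℝ, f ω {i} (fun _ => x) i * (x - individualBound μ P ξ f t i) := by
  simp only [backwardBound, individualBound, Finset.sum_add_distrib, Finset.mul_sum]
  rw [Finset.sum_comm]

lemma backwardBound_erase {ι Ω : Type*} [DecidableEq ι] [Fintype Ω] (μ : ℝ) (P : Ω → ℝ)
    (ξ : ι → ℝ) (f : Ω → SelectionProb ι) (t : ℕ) {S : Finset ι} {i : ι} (hi : i ∈ S) :
    backwardBound μ P ξ f t S =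
      backwardBound μ P ξ f t (S.erase i) + individualBound μ P ξ f t i :=
  (Finset.sum_erase_add S _ hi).symm

theorem optimalValue_le_backwardBound {ι Ω : Type*} [DecidableEq ι] [Fintype Ω]
    {Sbar : Finset ι} (ξ : ι → ℝ) {μ : ℝ} (hμ_pos : 0 < μ) (hμ_le : μ ≤ 1)
    {P : Ω → ℝ} (hP : P ∈ stdSimplex ℝ Ω) {f : Ω → SelectionProb ι}
    (hf : ∀ ω, IsSubstitutable Sbar (f ω)) (t : ℕ) :
    ∀ S ⊆ Sbar, optimalValue μ P ξ f t S ≤ backwardBound μ P ξ f t S := by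
  induction t with
  | zero => exact fun S _ => le_rfl
  | succ t ih =>
    intro S hS
    rw [backwardBound_succ, optimalValue]
    set d := backwardBound μ P ξ f t S - optimalValue μ P ξ f t S with hd
    have hd0 : 0 ≤ d := sub_nonneg.2 (ih S hS)
    have key : ∑ ω, P ω * stageValue (f ω) S
        (fun i => optimalValue μ P ξ f t S - optimalValue μ P ξ f t (S.erase i)) ≤
        (∑ ω, P ω * ∑ i ∈ S,
          ⨆ x : ℝ, f ω {i} (fun _ => x) i * (x - individualBound μ P ξ f t i)) + d := by
      calc _ ≤ ∑ ω, P ω * ((∑ i ∈ S, ⨆ x : ℝ,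
              f ω {i} (fun _ => x) i * (x - individualBound μ P ξ f t i)) + d) := by
            refine Finset.sum_le_sum fun ω _ => mul_le_mul_of_nonneg_left ?_ (hP.1 ω)
            refine (hf ω).stageValue_le_add hS hd0 fun i hi => ?_
            have h1 := backwardBound_erase μ P ξ f t hi
            have h2 := ih (S.erase i) ((S.erase_subset i).trans hS)
            linarith
        _ = _ := by simp only [mul_add, Finset.sum_add_distrib, ← Finset.sum_mul, hP.2, one_mul]
    have h1 := mul_le_mul_of_nonneg_left key hμ_pos.le
    have h2 : μ * d ≤ d := mul_le_of_le_one_left hd0 hμ_le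
    rw [mul_add] at h1
    linarith

/-! ### Logit pricing of one option and of a set -/

lemma exists_mul_exp_eq {y : ℝ} (hy : 0 < y) : ∃ w : ℝ, 0 < w ∧ w * Real.exp w = y := by
  have hc : ContinuousOn (fun w : ℝ => w * Real.exp w) (Set.Icc 0 y) := by fun_prop
  have h : y ∈ Set.Icc (0 * Real.exp 0) (y * Real.exp y) :=
    ⟨by simpa using hy.le, le_mul_of_one_le_right hy.le (Real.one_le_exp hy.le)⟩
  obtain ⟨w, hw, hwy⟩ := intermediate_value_Icc hy.le hc h
  refine ⟨w, hw.1.lt_of_ne ?_, hwy⟩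
  rintro rfl
  simp at hwy
  exact hy.ne hwy

section MultinomialLogit

variable {ι Ω : Type*} [DecidableEq ι] {q : Ω → ι → ℝ} {β : ℝ}

lemma mnl_of_mem (ω : Ω) (S : Finset ι) (p : S → ℝ) (i : S) :
    mnl q β ω S p i =
      Real.exp (q ω i + β * p i) / (1 + ∑ j : S, Real.exp (q ω j + β * p j)) := by
  simp [mnl]

lemma mnl_single (ω : Ω) (i : ι) (x : ℝ) :
    mnl q β ω {i} (fun _ => x) i =
      Real.exp (q ω i + β * x) / (1 + Real.exp (q ω i + β * x)) := by
  rw [mnl_of_mem ω {i} (fun _ => x) ⟨i, Finset.mem_singleton_self i⟩]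
  congr 2
  rw [Finset.sum_coe_sort ({i} : Finset ι) (fun j => Real.exp (q ω j + β * x)),
    Finset.sum_singleton]

/-- If `w` satisfies the optimality condition of the single-option problem with cost `r`, then
`w / (-β)` bounds the gain. -/
lemma mnl_single_gain_le (hβ : β < 0) (ω : Ω) (i : ι) {r w : ℝ}
    (hwr : w * Real.exp w = Real.exp (q ω i + β * r - 1)) (x : ℝ) :
    mnl q β ω {i} (fun _ => x) i * (x - r) ≤ w / (-β) := by
  rw [mnl_single, div_mul_eq_mul_div, div_le_div_iff₀ (by positivity) (by linarith)]
  -- The bound is the tangent inequality `z ≤ e^{z-1}`. Equality at `z = 1` yields the optimal price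
  -- `r + (1 + w) / (-β)`.
  set z := -β * (x - r) - w with hz
  have h1 : Real.exp (q ω i + β * x) * Real.exp (z - 1) = w := by
    have h : q ω i + β * x + (z - 1) = q ω i + β * r - 1 - w := by rw [hz]; ring
    rw [← Real.exp_add, h, Real.exp_sub, ← hwr, mul_div_assoc, div_self (Real.exp_pos _).ne',
      mul_one]
  have h2 : z ≤ Real.exp (z - 1) := by linarith [Real.add_one_le_exp (z - 1)]
  have h3 := mul_le_mul_of_nonneg_left h2 (Real.exp_pos (q ω i + β * x)).le
  rw [h1] at h3
  calc Real.exp (q ω i + β * x) * (x - r) * -β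
      = Real.exp (q ω i + β * x) * z + Real.exp (q ω i + β * x) * w := by rw [hz]; ring
    _ ≤ w * (1 + Real.exp (q ω i + β * x)) := by linarith

lemma exp_optimal_price (hβ : β < 0) (a : ℝ) {r w : ℝ}
    (hwr : w * Real.exp w = Real.exp (a + β * r - 1)) :
    Real.exp (a + β * (r + (1 + w) / (-β))) = w := by
  have h : a + β * (r + (1 + w) / (-β)) = a + β * r - 1 - w := by
    field_simp [hβ.ne]
    ring
  rw [h, Real.exp_sub, ← hwr, mul_div_assoc, div_self (Real.exp_pos _).ne', mul_one]

lemma mnl_single_iSup (hβ : β < 0) (ω : Ω) (i : ι) {r w : ℝ} (hw : 0 < w)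
    (hwr : w * Real.exp w = Real.exp (q ω i + β * r - 1)) :
    ⨆ x : ℝ, mnl q β ω {i} (fun _ => x) i * (x - r) = w / (-β) := by
  refine le_antisymm (ciSup_le (mnl_single_gain_le hβ ω i hwr)) ?_
  refine le_ciSup_of_le ⟨_, Set.forall_mem_range.2 (mnl_single_gain_le hβ ω i hwr)⟩
    (r + (1 + w) / (-β)) ?_
  rw [mnl_single, exp_optimal_price hβ _ hwr]
  have : (1 + w) ≠ 0 := by positivity
  have := hβ.ne
  refine le_of_eq ?_
  field_simp
  ring

theorem mnl_isSubstitutable (hβ : β < 0) (Sbar : Finset ι) (ω : Ω) :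
    IsSubstitutable Sbar (mnl q β ω) where
  nonneg S _ p i := by
    unfold mnl
    split_ifs <;> positivity
  sum_le_one S _ p := by
    simp only [mnl_of_mem, ← Finset.sum_div]
    rw [div_le_one (by positivity)]
    linarith
  le_single S _ p i := by
    rw [mnl_of_mem, mnl_single]
    have := Finset.single_le_sum (f := fun j : S => Real.exp (q ω j + β * p j))
      (fun j _ => (Real.exp_pos _).le) (Finset.mem_univ i)
    gcongr
  bddAbove_single i _ r := by
    obtain ⟨w, -, hwr⟩ := exists_mul_exp_eq (Real.exp_pos (q ω i + β * r - 1))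
    exact ⟨_, Set.forall_mem_range.2 (mnl_single_gain_le hβ ω i hwr)⟩

/-- The gain lost when each option is priced as if it were sold alone, with opportunity costs
`Δ i` in place of `r i`. -/
lemma sum_sub_stageValue_mnl_le (hβ : β < 0) (ω : Ω) (S : Finset ι) {r w Δ : ι → ℝ}
    (hw : ∀ i, 0 < w i)
    (hwr : ∀ i, w i * Real.exp (w i) = Real.exp (q ω i + β * r i - 1)) {c : ℝ}
    (hc : ∀ i ∈ S, (∑ j ∈ S, w j) / (-β) + Δ i - r i ≤ c) :
    (∑ i ∈ S, w i / (-β)) - stageValue (mnl q β ω) S Δ ≤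
      (∑ i ∈ S, w i) / (1 + ∑ i ∈ S, w i) * c := by
  have hle : stageGain (mnl q β ω) S Δ (fun i => r i + (1 + w i) / (-β)) ≤
      stageValue (mnl q β ω) S Δ :=
    le_ciSup ((mnl_isSubstitutable hβ S ω).bddAbove_stageGain subset_rfl Δ) _
  have hgain : stageGain (mnl q β ω) S Δ (fun i => r i + (1 + w i) / (-β)) =
      ∑ i ∈ S, w i / (1 + ∑ j ∈ S, w j) * (r i + (1 + w i) / (-β) - Δ i) := by
    rw [← Finset.sum_coe_sort S, stageGain]
    refine Finset.sum_congr rfl fun i _ => ?_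
    rw [mnl_of_mem]
    simp only [exp_optimal_price hβ _ (hwr _)]
    rw [Finset.sum_coe_sort S w]
  have hF : 0 ≤ ∑ j ∈ S, w j := Finset.sum_nonneg fun i _ => (hw i).le
  calc _ ≤ ∑ i ∈ S, (w i / (-β) -
          w i / (1 + ∑ j ∈ S, w j) * (r i + (1 + w i) / (-β) - Δ i)) := by
        rw [Finset.sum_sub_distrib, ← hgain]
        linarith
    _ ≤ ∑ i ∈ S, w i / (1 + ∑ j ∈ S, w j) * c := by
        refine Finset.sum_le_sum fun i hi => ?_
        -- At the single-option prices the attraction weights are exactly `w`, so the loss is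
        -- explicit; its term `-w i / (-β)` is dropped below.
        have h1 : w i / (-β) - w i / (1 + ∑ j ∈ S, w j) * (r i + (1 + w i) / (-β) - Δ i) =
            w i / (1 + ∑ j ∈ S, w j) * ((∑ j ∈ S, w j) / (-β) + Δ i - r i - w i / (-β)) := by
          have : 1 + ∑ j ∈ S, w j ≠ 0 := by positivity
          have := hβ.ne
          field_simp
          ring
        have h2 : 0 ≤ w i / (-β) := div_nonneg (hw i).le (by linarith)
        rw [h1]
        exact mul_le_mul_of_nonneg_left (by linarith [hc i hi])
          (div_nonneg (hw i).le (by positivity))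
    _ = _ := by rw [← Finset.sum_mul, ← Finset.sum_div]

end MultinomialLogit

/-! ### Convergence of the gap recursion -/

/-- Once `δ ≤ ε / 2`, the excess `D - ε / 2` is multiplied by at most `1 - a t ≤ e^{-a t}`, and
these factors have product zero. -/
lemma tendsto_zero_of_le_add_mul_sub {D a δ : ℕ → ℝ} (hD : ∀ t, 0 ≤ D t)
    (ha0 : ∀ t, 0 ≤ a t) (ha1 : ∀ t, a t ≤ 1)
    (hsum : Tendsto (fun n => ∑ t ∈ Finset.range n, a t) atTop atTop)
    (hδ : Tendsto δ atTop (𝓝 0)) (h : ∀ t, D (t + 1) ≤ D t + a t * (δ t - D t)) :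
    Tendsto D atTop (𝓝 0) := by
  refine tendsto_order.2 ⟨fun x hx => .of_forall fun t => hx.trans_le (hD t), fun ε hε => ?_⟩
  obtain ⟨N, hN⟩ := eventually_atTop.1 (hδ.eventually (gt_mem_nhds (half_pos hε)))
  -- The factor `D N`, rather than `D N - ε / 2`, keeps the right side nonnegative, as replacing `1
  -- - a n` by `e^{-a n}` requires.
  have hstep : ∀ n ≥ N, D n - ε / 2 ≤
      D N * Real.exp (∑ t ∈ Finset.range N, a t - ∑ t ∈ Finset.range n, a t) := by
    intro n hn
    induction n, hn using Nat.le_induction with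
    | base => simp only [sub_self, Real.exp_zero]; linarith
    | succ n hn ih =>
      have h1 : D (n + 1) - ε / 2 ≤ (1 - a n) * (D n - ε / 2) := by
        have := mul_le_mul_of_nonneg_left (hN n hn).le (ha0 n)
        linarith [h n]
      have h2 := mul_le_mul_of_nonneg_left ih (sub_nonneg.2 (ha1 n))
      have h3 : 1 - a n ≤ Real.exp (-a n) := Real.one_sub_le_exp_neg _
      rw [Finset.sum_range_succ, ← sub_sub, sub_eq_add_neg _ (a n), Real.exp_add]
      have h4 := mul_le_mul_of_nonneg_right h3 (mul_nonneg (hD N)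
        (Real.exp_pos (∑ t ∈ Finset.range N, a t - ∑ t ∈ Finset.range n, a t)).le)
      linarith
  have hlim : Tendsto (fun n => D N *
      Real.exp (∑ t ∈ Finset.range N, a t - ∑ t ∈ Finset.range n, a t)) atTop (𝓝 0) := by
    have h1 : Tendsto (fun n => ∑ t ∈ Finset.range N, a t - ∑ t ∈ Finset.range n, a t)
        atTop atBot := by
      simp only [sub_eq_add_neg]
      exact tendsto_atBot_add_const_left _ _ (tendsto_neg_atTop_atBot.comp hsum)
    simpa using (Real.tendsto_exp_atBot.comp h1).const_mul (D N)
  filter_upwards [eventually_ge_atTop N, hlim.eventually (gt_mem_nhds (half_pos hε))]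
    with n hn hn2
  linarith [hstep n hn]

/-! ### Asymptotic tightness under logit -/

section Asymptotics

variable {ι Ω : Type*} [DecidableEq ι] [Fintype Ω] {q : Ω → ι → ℝ} {β μ : ℝ} {P : Ω → ℝ}
  {ξ : ι → ℝ} {w : Ω → ι → ℝ → ℝ}

lemma individualBound_mnl_succ (hβ : β < 0) (hw : ∀ ω i r, 0 < w ω i r)
    (hwr : ∀ ω i r, w ω i r * Real.exp (w ω i r) = Real.exp (q ω i + β * r - 1))
    (t : ℕ) (i : ι) :
    individualBound μ P ξ (mnl q β) (t + 1) i = individualBound μ P ξ (mnl q β) t i +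
      μ * ∑ ω, P ω * (w ω i (individualBound μ P ξ (mnl q β) t i) / (-β)) := by
  rw [individualBound]
  simp only [mnl_single_iSup hβ _ i (hw _ i _) (hwr _ i _)]

lemma monotone_individualBound_mnl (hβ : β < 0) (hμ_pos : 0 < μ) (hP : P ∈ stdSimplex ℝ Ω)
    (i : ι) : Monotone fun t => individualBound μ P ξ (mnl q β) t i := by
  refine monotone_nat_of_le_succ fun t => ?_
  rw [individualBound]
  exact le_add_of_nonneg_right (mul_nonneg hμ_pos.le (Finset.sum_nonneg fun ω _ =>
    mul_nonneg (hP.1 ω) ((mnl_isSubstitutable hβ {i} ω).single_iSup_nonneg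
      (Finset.mem_singleton_self i) _)))

/-- Since `w` decreases in `r`, a finite limit `l` would force every increment to be at least the
positive value it has at `l`. -/
theorem tendsto_individualBound_mnl (hβ : β < 0) (hμ_pos : 0 < μ) (hP : P ∈ stdSimplex ℝ Ω)
    (hw : ∀ ω i r, 0 < w ω i r)
    (hwr : ∀ ω i r, w ω i r * Real.exp (w ω i r) = Real.exp (q ω i + β * r - 1)) (i : ι) :
    Tendsto (fun t => individualBound μ P ξ (mnl q β) t i) atTop atTop := by
  refine (tendsto_atTop_of_monotone (monotone_individualBound_mnl hβ hμ_pos hP i)).resolve_right ?_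
  rintro ⟨l, hl⟩
  have hle : ∀ t, individualBound μ P ξ (mnl q β) t i ≤ l := fun t =>
    (monotone_individualBound_mnl hβ hμ_pos hP i).ge_of_tendsto hl t
  have hwmono : ∀ ω r, r ≤ l → w ω i l ≤ w ω i r := by
    intro ω r hr
    by_contra! hlt
    have h1 : w ω i r * Real.exp (w ω i r) < w ω i l * Real.exp (w ω i l) :=
      mul_lt_mul'' hlt (Real.exp_lt_exp.2 hlt) (hw ω i r).le (Real.exp_pos _).le
    rw [hwr, hwr, Real.exp_lt_exp] at h1
    nlinarith
  set s := μ * ∑ ω, P ω * (w ω i l / (-β)) with hs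
  have hs0 : 0 < s := by
    refine mul_pos hμ_pos ?_
    obtain ⟨ω, -, hω⟩ : ∃ ω ∈ Finset.univ, 0 < P ω :=
      Finset.exists_lt_of_sum_lt (f := fun _ => (0 : ℝ)) (by simp [hP.2])
    have hpos : ∀ ω, 0 < w ω i l / (-β) := fun ω => div_pos (hw ω i l) (by linarith)
    exact Finset.sum_pos' (fun ω _ => mul_nonneg (hP.1 ω) (hpos ω).le)
      ⟨ω, Finset.mem_univ ω, mul_pos hω (hpos ω)⟩
  have hinc : ∀ t, individualBound μ P ξ (mnl q β) t i + s ≤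
      individualBound μ P ξ (mnl q β) (t + 1) i := by
    intro t
    rw [individualBound_mnl_succ hβ hw hwr, hs]
    refine add_le_add_right (mul_le_mul_of_nonneg_left (Finset.sum_le_sum fun ω _ =>
      mul_le_mul_of_nonneg_left ?_ (hP.1 ω)) hμ_pos.le) _
    exact div_le_div_of_nonneg_right (hwmono ω _ (hle t)) (by linarith)
  have := le_of_tendsto_of_tendsto' (hl.add_const s) ((tendsto_add_atTop_iff_nat 1).2 hl) hinc
  linarith

theorem tendsto_backwardBound_sub_optimalValue_mnl (hβ : β < 0) (hμ_pos : 0 < μ) (hμ_le : μ ≤ 1)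
    (hP : P ∈ stdSimplex ℝ Ω) (S : Finset ι) :
    Tendsto (fun t => backwardBound μ P ξ (mnl q β) t S - optimalValue μ P ξ (mnl q β) t S)
      atTop (𝓝 0) := by
  have hex : ∀ ω i r, ∃ w : ℝ, 0 < w ∧ w * Real.exp w = Real.exp (q ω i + β * r - 1) :=
    fun ω i r => exists_mul_exp_eq (Real.exp_pos _)
  choose w hw hwr using hex
  have hle : ∀ S t, 0 ≤ backwardBound μ P ξ (mnl q β) t S - optimalValue μ P ξ (mnl q β) t S :=
    fun S t => sub_nonneg.2 (optimalValue_le_backwardBound ξ hμ_pos hμ_le hP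
      (mnl_isSubstitutable hβ S) t S subset_rfl)
  induction S using Finset.strongInduction with
  | H S ih =>
  rcases S.eq_empty_or_nonempty with rfl | ⟨i₀, hi₀⟩
  · have h0 : ∀ t, optimalValue μ P ξ (mnl q β) t ∅ = 0 := by
      intro t
      induction t with
      | zero => simp [optimalValue]
      | succ t iht => simp [optimalValue, iht, stageValue, stageGain]
    simp [h0, backwardBound]
  set r := individualBound μ P ξ (mnl q β) with hr
  set V := optimalValue μ P ξ (mnl q β) with hV
  set W := backwardBound μ P ξ (mnl q β) with hW
  set F : ℕ → Ω → ℝ := fun t ω => ∑ i ∈ S, w ω i (r t i) with hF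
  -- A bound on `F` uniform in the type, from `w ≤ w e^w`; it tends to zero as `r → ∞`.
  set η : ℕ → ℝ := fun t => ∑ ω, ∑ i ∈ S, Real.exp (q ω i + β * r t i - 1) with hη
  set a : ℕ → ℝ := fun t => μ * ∑ ω, P ω * (F t ω / (1 + F t ω)) with ha
  set δ : ℕ → ℝ := fun t => η t / (-β) + ∑ i ∈ S, (W t (S.erase i) - V t (S.erase i)) with hδ
  have hF0 : ∀ t ω, 0 ≤ F t ω := fun t ω => Finset.sum_nonneg fun i _ => (hw ω i _).le
  have hFη : ∀ t ω, F t ω ≤ η t := by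
    intro t ω
    calc F t ω ≤ ∑ i ∈ S, Real.exp (q ω i + β * r t i - 1) := by
          refine Finset.sum_le_sum fun i _ => ?_
          rw [← hwr]
          exact le_mul_of_one_le_right (hw _ _ _).le (Real.one_le_exp (hw _ _ _).le)
      _ ≤ η t := Finset.single_le_sum
          (f := fun ω => ∑ i ∈ S, Real.exp (q ω i + β * r t i - 1))
          (fun ω _ => Finset.sum_nonneg fun i _ => (Real.exp_pos _).le) (Finset.mem_univ ω)
  have hη0 : ∀ t, η t ≤ η 0 := by
    intro t
    refine Finset.sum_le_sum fun ω _ => Finset.sum_le_sum fun i _ => Real.exp_le_exp.2 ?_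
    have : r 0 i ≤ r t i := monotone_individualBound_mnl hβ hμ_pos hP i (Nat.zero_le t)
    linarith [mul_le_mul_of_nonpos_left this hβ.le]
  have hrlim : ∀ i, Tendsto (fun t => r t i) atTop atTop :=
    tendsto_individualBound_mnl hβ hμ_pos hP hw hwr
  have hηlim : Tendsto η atTop (𝓝 0) := by
    have h : ∀ ω, ∀ i, Tendsto (fun t => Real.exp (q ω i + β * r t i - 1)) atTop (𝓝 0) :=
      fun ω i => Real.tendsto_exp_atBot.comp (tendsto_atBot_add_const_right _ _
        (tendsto_atBot_add_const_left _ _ ((hrlim i).const_mul_atTop_of_neg hβ)))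
    simpa using tendsto_finsetSum Finset.univ fun ω _ =>
      tendsto_finsetSum S fun i _ => h ω i
  have hδlim : Tendsto δ atTop (𝓝 0) := by
    simpa only [zero_div, Finset.sum_const_zero, add_zero] using (hηlim.div_const (-β)).add
      (tendsto_finsetSum S fun i hi => ih (S.erase i) (Finset.erase_ssubset hi))
  have hfrac0 : ∀ t ω, 0 ≤ F t ω / (1 + F t ω) := fun t ω =>
    div_nonneg (hF0 t ω) (by linarith [hF0 t ω])
  have hfrac1 : ∀ t ω, F t ω / (1 + F t ω) ≤ 1 := fun t ω =>
    div_le_one_of_le₀ (by linarith) (by linarith [hF0 t ω])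
  have ha0 : ∀ t, 0 ≤ a t := fun t =>
    mul_nonneg hμ_pos.le (Finset.sum_nonneg fun ω _ => mul_nonneg (hP.1 ω) (hfrac0 t ω))
  have ha1 : ∀ t, a t ≤ 1 := by
    intro t
    refine mul_le_one₀ hμ_le
      (Finset.sum_nonneg fun ω _ => mul_nonneg (hP.1 ω) (hfrac0 t ω)) ?_
    exact (Finset.sum_le_sum fun ω _ =>
      mul_le_of_le_one_right (hP.1 ω) (hfrac1 t ω)).trans hP.2.le
  have hη00 : 0 ≤ η 0 := Finset.sum_nonneg fun ω _ =>
    Finset.sum_nonneg fun i _ => (Real.exp_pos _).le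
  -- The increment of `r` at `i₀` is `μ E[w] / (-β)`, while `a t` is at least `μ E[w] / (1 + η 0)`.
  -- The increments telescope, so the sum of `a` inherits the divergence of `r`.
  have hainc : ∀ t, (-β) / (1 + η 0) * (r (t + 1) i₀ - r t i₀) ≤ a t := by
    intro t
    have h1 : (-β) / (1 + η 0) * (r (t + 1) i₀ - r t i₀) =
        μ * ∑ ω, P ω * (w ω i₀ (r t i₀) / (1 + η 0)) := by
      rw [hr, individualBound_mnl_succ hβ hw hwr, add_sub_cancel_left, mul_left_comm,
        Finset.mul_sum]
      congr 1
      refine Finset.sum_congr rfl fun ω _ => ?_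
      have := hβ.ne
      field_simp
    rw [h1]
    refine mul_le_mul_of_nonneg_left (Finset.sum_le_sum fun ω _ =>
      mul_le_mul_of_nonneg_left ?_ (hP.1 ω)) hμ_pos.le
    exact div_le_div₀ (hF0 t ω)
      (Finset.single_le_sum (f := fun i => w ω i (r t i)) (fun i _ => (hw ω i _).le) hi₀)
      (by linarith [hF0 t ω]) (by linarith [hFη t ω, hη0 t])
  have hsum : Tendsto (fun n => ∑ t ∈ Finset.range n, a t) atTop atTop := by
    have hpos : 0 < (-β) / (1 + η 0) := div_pos (by linarith) (by linarith)
    refine tendsto_atTop_mono (fun n => ?_)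
      ((tendsto_atTop_add_const_right _ (-r 0 i₀) (hrlim i₀)).const_mul_atTop hpos)
    rw [← sub_eq_add_neg, ← Finset.sum_range_sub (fun t => r t i₀), Finset.mul_sum]
    exact Finset.sum_le_sum fun t _ => hainc t
  refine tendsto_zero_of_le_add_mul_sub (hle S) ha0 ha1 hsum hδlim fun t => ?_
  have hloss : ∀ ω, (∑ i ∈ S, w ω i (r t i) / (-β)) -
      stageValue (mnl q β ω) S (fun i => V t S - V t (S.erase i)) ≤
      F t ω / (1 + F t ω) * (δ t - (W t S - V t S)) := by
    intro ω
    refine sum_sub_stageValue_mnl_le hβ ω S (r := r t) (w := fun i => w ω i (r t i))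
      (fun i => hw ω i _) (fun i => hwr ω i _) fun i hi => ?_
    -- Hence `Δ_i - r_i` is the gap at `S \ {i}` minus the gap at `S`; the latter gives the
    -- contraction.
    have h1 : W t S = W t (S.erase i) + r t i := backwardBound_erase μ P ξ _ t hi
    have h2 := Finset.single_le_sum (f := fun i => W t (S.erase i) - V t (S.erase i))
      (fun i _ => hle (S.erase i) t) hi
    have h3 : F t ω / (-β) ≤ η t / (-β) := div_le_div_of_nonneg_right (hFη t ω) (by linarith)
    simp only [hδ]
    simp only [hF] at h3
    linarith
  have hWs : W (t + 1) S = W t S + μ * ∑ ω, P ω * ∑ i ∈ S, w ω i (r t i) / (-β) := by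
    rw [hW, backwardBound_succ]
    simp only [mnl_single_iSup hβ _ _ (hw _ _ _) (hwr _ _ _), hr]
  have hVs : V (t + 1) S = V t S + μ * ∑ ω, P ω * stageValue (mnl q β ω) S
      (fun i => V t S - V t (S.erase i)) := by
    rw [hV, optimalValue]
  have hsumle : ∑ ω, P ω * ((∑ i ∈ S, w ω i (r t i) / (-β)) -
      stageValue (mnl q β ω) S (fun i => V t S - V t (S.erase i))) ≤
      ∑ ω, P ω * (F t ω / (1 + F t ω) * (δ t - (W t S - V t S))) :=
    Finset.sum_le_sum fun ω _ => mul_le_mul_of_nonneg_left (hloss ω) (hP.1 ω)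
  simp only [← mul_assoc, ← Finset.sum_mul] at hsumle
  simp only [mul_sub, Finset.sum_sub_distrib] at hsumle
  have hfin := mul_le_mul_of_nonneg_left hsumle hμ_pos.le
  rw [hWs, hVs]
  simp only [ha]
  linarith

end Asymptotics

lemma tendsto_numPeriods_atTop {μ : ℝ} (hμ_pos : 0 < μ) :
    Tendsto (numPeriods μ) atTop atTop :=
  tendsto_nat_floor_atTop.comp (tendsto_id.atTop_div_const hμ_pos)

theorem mainTheorem6 {ι Ω : Type*} [DecidableEq ι] [Fintype Ω]
    (Sbar : Finset ι) (ξ : ι → ℝ)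
    (μ : ℝ) (hμ_pos : 0 < μ) (hμ_le : μ ≤ 1)
    (P : Ω → ℝ) (hP : P ∈ stdSimplex ℝ Ω) :
    (∀ f : Ω → SelectionProb ι, IsChoiceFunction Sbar f →
      (∀ ω, ∀ S ⊆ Sbar, ∀ Δ : ι → ℝ, BddAbove (Set.range (stageGain (f ω) S Δ))) ∧
      (∀ S ⊆ Sbar, ∀ t : ℕ, optimalValue μ P ξ f t S ≤ backwardBound μ P ξ f t S)) ∧
    (∀ (q : Ω → ι → ℝ) (β : ℝ), β < 0 →
      (∀ ω, ∀ S ⊆ Sbar, ∀ Δ : ι → ℝ, BddAbove (Set.range (stageGain (mnl q β ω) S Δ))) ∧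
      (∀ S ⊆ Sbar,
        Tendsto (fun lam : ℝ => optimalValue μ P ξ (mnl q β) (numPeriods μ lam) S -
            backwardBound μ P ξ (mnl q β) (numPeriods μ lam) S)
          atTop (𝓝 0))) := by
  refine ⟨fun f hf => ⟨fun ω S hS Δ => (hf.isSubstitutable ω).bddAbove_stageGain hS Δ,
    fun S hS t => optimalValue_le_backwardBound ξ hμ_pos hμ_le hP hf.isSubstitutable t S hS⟩,
    fun q β hβ => ⟨fun ω S hS Δ => (mnl_isSubstitutable hβ Sbar ω).bddAbove_stageGain hS Δ,
      fun S _ => ?_⟩⟩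
  have h := ((tendsto_backwardBound_sub_optimalValue_mnl (q := q) (ξ := ξ) hβ hμ_pos hμ_le hP
    S).comp (tendsto_numPeriods_atTop hμ_pos)).neg
  simpa [Function.comp_def] using h
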